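/- A COND oracle for a probability distribution $D$ over $[N]=\{1,\dots,N\}$ takes a query set $S\subseteq[N]$ and, if $D(S)=\sum_{i\in S}D(i)>0$, returns $i\in S$ with probability $D(i)/D(S)$, independently of all previous calls; if $D(S)=0$, the algorithm ends with "failure". Let $d_{TV}(D_1,D_2)=\frac12\sum_{i\in[N]}|D_1(i)-D_2(i)|$. Theorem. There are an absolute constant $C$, an integer $k\ge 0$ and, for every integer $N\ge 1$ and every real $0<\varepsilon\le 1$, a randomized adaptive algorithm $T_{N,\varepsilon}$ with access to COND oracles of two unknown distributions over $[N]$, such that, for all distributions $D_1,D_2$ over $[N]$: 1. $T_{N,\varepsilon}$ always makes at most $C\,g\,(\log(2+g))^k$ oracle calls in total, where $g=(\log N)^5/\varepsilon^4$; that is, it makes $\tilde O\big((\log N)^5/\varepsilon^4\big)$ queries; 2. if $D_1=D_2$, then $T_{N,\varepsilon}$ outputs ACCEPT with probability at least $2/3$; 3. if $d_{TV}(D_1,D_2)\ge\varepsilon$, then $T_{N,\varepsilon}$ outputs REJECT with probability at least $2/3$. -/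

import Mathlib

noncomputable section

namespace CondTesting

/-- The possible results of a run of a testing algorithm. `failure` is also the result of a run in
which the algorithm queries a set of probability zero. -/
inductive Verdict : Type
  | accept : Verdict
  | reject : Verdict
  | failure : Verdict

/-- A randomized adaptive algorithm with access to conditional sampling oracles of two
distributions over an `N`-element set, as a finite decision tree. It may halt with a verdict, toss
a fair coin and continue according to the result, or query the oracle of the distribution number
`o` on a set `S` and continue according to the returned element. -/
inductive CondAlgorithm (N : ℕ) : Type
  | halt (v : Verdict) : CondAlgorithm N
  | toss (next : Bool → CondAlgorithm N) : CondAlgorithm N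
  | query (o : Fin 2) (S : Finset (Fin N)) (next : Fin N → CondAlgorithm N) : CondAlgorithm N

namespace CondAlgorithm

variable {N : ℕ}

/-- The maximal number of oracle calls (to both oracles together) on any path of execution, that
is, over all coin tosses and all oracle answers `i ∈ S` to a query `S`. -/
def queries : CondAlgorithm N → ℕ
  | halt _ => 0
  | toss next => max (queries (next true)) (queries (next false))
  | query _ S next => 1 + S.sup (fun i => queries (next i))

open Classical in
/-- The distribution of the verdict when oracle number `o` is the conditional sampling oracle of
`D o`. A query `S` with `D o S > 0` returns `i ∈ S` with probability `D o i / D o S`, independently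
of everything before; a query of probability zero ends the run with `failure`. -/
def run (D : Fin 2 → PMF (Fin N)) : CondAlgorithm N → PMF Verdict
  | halt v => PMF.pure v
  | toss next => (PMF.uniformOfFintype Bool).bind (fun b => run D (next b))
  | query o S next =>
      if h : ∃ i ∈ (S : Set (Fin N)), i ∈ (D o).support then
        ((D o).filter S h).bind (fun i => run D (next i))
      else PMF.pure Verdict.failure

end CondAlgorithm

/-- Total variation distance, half of the `ℓ₁` distance. -/
def dTV {N : ℕ} (D₁ D₂ : PMF (Fin N)) : ℝ :=
  (1 / 2) * ∑ i, |(D₁ i).toReal - (D₂ i).toReal|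

/-- `A` tests whether two unknown distributions over an `N`-element set are equal or at
distance at least `ε`. -/
def IsEqualityTester {N : ℕ} (A : CondAlgorithm N) (ε : ℝ) : Prop :=
  ∀ D₁ D₂ : PMF (Fin N),
    (D₁ = D₂ → 2 / 3 ≤ (A.run ![D₁, D₂] Verdict.accept).toReal) ∧
    (ε ≤ dTV D₁ D₂ → 2 / 3 ≤ (A.run ![D₁, D₂] Verdict.reject).toReal)

/-- `f = Õ(g)` uniformly over the parameters in `s`: `f` is at most a constant times `g` times a
fixed power of `log g` (where `2 + g` keeps the logarithm away from zero). -/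
def IsSoftO {α : Type*} (s : Set α) (f g : α → ℝ) : Prop :=
  ∃ (C : ℝ) (k : ℕ), ∀ x ∈ s, f x ≤ C * (g x * Real.log (2 + g x) ^ k)

end CondTesting

end

noncomputable section

namespace CondTesting

namespace CondAlgorithm

variable {N : ℕ}

/-! Halve `[N]` repeatedly, giving a binary tree of depth `n = ⌈log₂ N⌉`. Let `d(S)` be the distance
of the two distributions conditioned on a node `S`. If they give the child `B` the conditional
probabilities `p` and `q`, then `d(S) ≤ p d(B) + (1 - p) d(S \ B) + |p - q|` (`condDist_le`). At a
leaf `d = 0`, so distant distributions must split many nodes differently, and a random path drawn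
from the first oracle tends to meet such a node.

Each node compares counts from `m` samples of either oracle with the threshold `τ = mδ`. By
Chebyshev the error is at most `1 / (2mδ²)`, both when `p = q` and when `|p - q| ≥ 2δ`. At
intermediate nodes a rejection does no harm in the distant case, and passing costs `d` little. The
second oracle may give the chosen child probability zero, and querying it would then be fatal; so
the child is entered only after that oracle has hit it, in at most `h` trials. This loses `p (1 - q)
^ h ≤ 1 / h + |p - q|` per child.

One walk thus rejects with probability at least `d - n (6δ + 2 / h) - 1 / (2mδ²)`
(`prob_reject_walk_ge`), which is at least `ε / 4` for suitable parameters, and `O(1 / ε)` walks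
suffice. For equal distributions a union bound over all comparisons applies
(`prob_accept_repeatWalk_ge`); it forces `m` of order `(n / ε)³`. The total is `O((n / ε)⁴)`
queries. -/

/-- The probability that a run ends with the verdict `v`. -/
def prob (D : Fin 2 → PMF (Fin N)) (v : Verdict) (A : CondAlgorithm N) : ℝ :=
  (A.run D v).toReal

/-- The probability of a set under a distribution, as a real number. -/
def mass (D : PMF (Fin N)) (S : Finset (Fin N)) : ℝ :=
  ∑ i ∈ S, (D i).toReal

/-! ### Masses and conditional probabilities of sets -/

section Mass

variable (D : PMF (Fin N))

lemma mass_nonneg (S : Finset (Fin N)) : 0 ≤ mass D S :=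
  Finset.sum_nonneg fun _ _ => ENNReal.toReal_nonneg

lemma mass_univ : mass D Finset.univ = 1 := by
  have h := D.tsum_coe
  rw [tsum_fintype] at h
  rw [mass, ← ENNReal.toReal_sum fun i _ => D.apply_ne_top i, h, ENNReal.toReal_one]

lemma mass_add_sdiff {S B : Finset (Fin N)} (hB : B ⊆ S) :
    mass D B + mass D (S \ B) = mass D S := by
  rw [add_comm]
  exact Finset.sum_sdiff hB

lemma mass_mono {S B : Finset (Fin N)} (hB : B ⊆ S) : mass D B ≤ mass D S := by
  have h1 := mass_add_sdiff D hB
  have h2 := mass_nonneg D (S \ B)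
  linarith

lemma toReal_le_mass {S : Finset (Fin N)} {i : Fin N} (hi : i ∈ S) :
    (D i).toReal ≤ mass D S :=
  Finset.single_le_sum (f := fun i => (D i).toReal) (fun _ _ => ENNReal.toReal_nonneg) hi

lemma mass_div_nonneg (S B : Finset (Fin N)) : 0 ≤ mass D B / mass D S :=
  div_nonneg (mass_nonneg D B) (mass_nonneg D S)

lemma mass_div_le_one {S B : Finset (Fin N)} (hB : B ⊆ S) : mass D B / mass D S ≤ 1 :=
  div_le_one_of_le₀ (mass_mono D hB) (mass_nonneg D S)

lemma mass_sdiff_div {S B : Finset (Fin N)} (hB : B ⊆ S) (hS : 0 < mass D S) :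
    mass D (S \ B) / mass D S = 1 - mass D B / mass D S := by
  rw [← mass_add_sdiff D hB] at hS ⊢
  field_simp
  ring

end Mass

/-! ### Verdict probabilities across a single query -/

section Prob

variable (D : Fin 2 → PMF (Fin N)) (v : Verdict)

lemma prob_nonneg (A : CondAlgorithm N) : 0 ≤ prob D v A :=
  ENNReal.toReal_nonneg

lemma prob_le_one (A : CondAlgorithm N) : prob D v A ≤ 1 := by
  have h := ENNReal.toReal_mono ENNReal.one_ne_top ((A.run D).coe_le_one v)
  simpa [prob] using h

lemma prob_halt_self : prob D v (halt v) = 1 := by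
  simp [prob, run]

lemma prob_query {o : Fin 2} {S : Finset (Fin N)} (hS : 0 < mass (D o) S)
    (next : Fin N → CondAlgorithm N) :
    prob D v (query o S next)
      = ∑ i ∈ S, (D o i).toReal / mass (D o) S * prob D v (next i) := by
  classical
  obtain ⟨j, hj, hj0⟩ := Finset.exists_ne_zero_of_sum_ne_zero hS.ne'
  have h : ∃ i ∈ (S : Set (Fin N)), i ∈ (D o).support := by
    refine ⟨j, hj, fun h0 => hj0 ?_⟩
    simp [h0]
  have hsum : (∑' a, (S : Set (Fin N)).indicator (D o) a) = ∑ i ∈ S, D o i := by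
    rw [tsum_fintype, Finset.sum_indicator_subset (D o) (Finset.subset_univ S)]
  rw [prob, run, dif_pos h, PMF.bind_apply, tsum_fintype, ENNReal.toReal_sum]
  · rw [← Finset.sum_subset (Finset.subset_univ S)]
    · refine Finset.sum_congr rfl fun i hi => ?_
      rw [ENNReal.toReal_mul, PMF.filter_apply, hsum, Set.indicator_of_mem (by exact hi),
        ENNReal.toReal_mul, ENNReal.toReal_inv,
        ENNReal.toReal_sum fun i _ => (D o).apply_ne_top i, div_eq_mul_inv]
      rfl
    · intro i _ hi
      rw [PMF.filter_apply, Set.indicator_of_notMem (by exact hi)]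
      simp
  · intro i _
    exact ENNReal.mul_ne_top (PMF.apply_ne_top _ _) (PMF.apply_ne_top _ _)

/-- A lower bound for the outcome of a query in terms of the part `B` of the queried set. -/
lemma prob_query_ge {o : Fin 2} {S B : Finset (Fin N)} (hS : 0 < mass (D o) S) (hB : B ⊆ S)
    {next : Fin N → CondAlgorithm N} {x y : ℝ}
    (hx : ∀ i ∈ B, 0 < (D o i).toReal → x ≤ prob D v (next i))
    (hy : ∀ i ∈ S \ B, 0 < (D o i).toReal → y ≤ prob D v (next i)) :
    mass (D o) B / mass (D o) S * x + (1 - mass (D o) B / mass (D o) S) * y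
      ≤ prob D v (query o S next) := by
  have key : ∀ (T : Finset (Fin N)) (z : ℝ),
      (∀ i ∈ T, 0 < (D o i).toReal → z ≤ prob D v (next i)) →
      mass (D o) T / mass (D o) S * z
        ≤ ∑ i ∈ T, (D o i).toReal / mass (D o) S * prob D v (next i) := by
    intro T z hz
    rw [mass, Finset.sum_div, Finset.sum_mul]
    refine Finset.sum_le_sum fun i hi => ?_
    rcases (ENNReal.toReal_nonneg (a := D o i)).eq_or_lt with h0 | h0
    · simp [← h0]
    · exact mul_le_mul_of_nonneg_left (hz i hi h0) (div_nonneg h0.le hS.le)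
  rw [prob_query D v hS, ← mass_sdiff_div (D o) hB hS, ← Finset.sum_sdiff hB]
  have h1 := key B x hx
  have h2 := key (S \ B) y hy
  linarith

end Prob

/-! ### The building blocks of the tester -/

open Classical in
/-- Draw `m` samples from either oracle on `S` and continue with `t` increased by the difference of
the numbers of samples in `B`. -/
def compare (S B : Finset (Fin N)) (k : ℤ → CondAlgorithm N) : ℕ → ℤ → CondAlgorithm N
  | 0, t => k t
  | m + 1, t => query 0 S fun x => query 1 S fun y =>
      compare S B k m (t + (if x ∈ B then 1 else 0) - (if y ∈ B then 1 else 0))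

open Classical in
/-- Draw at most `h` samples from oracle `1` on `S`, continue with `hit` as soon as one of them is
in `B`, and with `miss` if none is. -/
def hunt (S B : Finset (Fin N)) (hit miss : CondAlgorithm N) : ℕ → CondAlgorithm N
  | 0 => miss
  | h + 1 => query 1 S fun y => if y ∈ B then hit else hunt S B hit miss h

/-- A subset of half the size. -/
def half (S : Finset (Fin N)) : Finset (Fin N) :=
  (Finset.exists_subset_card_eq (Nat.div_le_self S.card 2)).choose

lemma half_subset (S : Finset (Fin N)) : half S ⊆ S :=
  (Finset.exists_subset_card_eq (Nat.div_le_self S.card 2)).choose_spec.1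

lemma card_half (S : Finset (Fin N)) : (half S).card = S.card / 2 :=
  (Finset.exists_subset_card_eq (Nat.div_le_self S.card 2)).choose_spec.2

lemma card_half_le {S : Finset (Fin N)} {l : ℕ} (hS : S.card ≤ 2 ^ (l + 1)) :
    (half S).card ≤ 2 ^ l := by
  rw [card_half]
  omega

lemma card_sdiff_half_le {S : Finset (Fin N)} {l : ℕ} (hS : S.card ≤ 2 ^ (l + 1)) :
    (S \ half S).card ≤ 2 ^ l := by
  rw [Finset.card_sdiff_of_subset (half_subset S), card_half]
  omega

open Classical in
/-- Choose the half of `S` that contains a sample of oracle `0` and continue with it, if oracle `1`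
is seen to give it positive probability, and with `K` otherwise. -/
def descend (h : ℕ) (S : Finset (Fin N)) (next : Finset (Fin N) → CondAlgorithm N)
    (K : CondAlgorithm N) : CondAlgorithm N :=
  query 0 S fun x =>
    if x ∈ half S then hunt S (half S) (next (half S)) K h
    else hunt S (S \ half S) (next (S \ half S)) K h

open Classical in
/-- Follow a path of length `l` down the tree of halves. At each node compare how the two
distributions split it, and reject if the difference exceeds the threshold `τ`. At the end of the
path continue with `K`. -/
def walk (τ : ℝ) (m h : ℕ) (K : CondAlgorithm N) : ℕ → Finset (Fin N) → CondAlgorithm N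
  | 0, _ => K
  | l + 1, S => compare S (half S)
      (fun t => if τ < |(t : ℝ)| then halt Verdict.reject
        else descend h S (walk τ m h K l) K) m 0

/-- Walk `r` times, and accept if no walk rejects. -/
def repeatWalk (τ : ℝ) (m h n : ℕ) : ℕ → CondAlgorithm N
  | 0 => halt Verdict.accept
  | r + 1 => walk τ m h (repeatWalk τ m h n r) n Finset.univ

/-! ### The number of queries -/

lemma queries_query_le {o : Fin 2} {S : Finset (Fin N)} {next : Fin N → CondAlgorithm N} {b : ℕ}
    (hb : ∀ i, (next i).queries ≤ b) : (query o S next).queries ≤ 1 + b :=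
  Nat.add_le_add_left (Finset.sup_le fun i _ => hb i) 1

lemma queries_compare_le {S B : Finset (Fin N)} {k : ℤ → CondAlgorithm N} {b : ℕ}
    (hb : ∀ t, (k t).queries ≤ b) (m : ℕ) (t : ℤ) :
    (compare S B k m t).queries ≤ 2 * m + b := by
  induction m generalizing t with
  | zero => simpa [compare] using hb t
  | succ m ih =>
    have h := queries_query_le (o := 0) (S := S) fun x =>
      queries_query_le (o := 1) (S := S) fun y =>
        ih (t + (if x ∈ B then 1 else 0) - (if y ∈ B then 1 else 0))
    rw [compare]
    convert h.trans (by omega : _ ≤ 2 * (m + 1) + b) using 1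

lemma queries_hunt_le {S B : Finset (Fin N)} {hit miss : CondAlgorithm N} {b : ℕ}
    (h1 : hit.queries ≤ b) (h2 : miss.queries ≤ b) (h : ℕ) :
    (hunt S B hit miss h).queries ≤ h + b := by
  induction h with
  | zero => simpa [hunt] using h2
  | succ h ih =>
    rw [hunt]
    refine (queries_query_le (b := h + b) fun y => ?_).trans (by omega)
    split_ifs
    · omega
    · exact ih

lemma queries_walk_le (τ : ℝ) (m h : ℕ) (K : CondAlgorithm N) (l : ℕ) (S : Finset (Fin N)) :
    (walk τ m h K l S).queries ≤ l * (2 * m + h + 1) + K.queries := by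
  induction l generalizing S with
  | zero => simp [walk]
  | succ l ih =>
    rw [walk]
    refine (queries_compare_le (b := 1 + (h + (l * (2 * m + h + 1) + K.queries)))
      (fun t => ?_) m 0).trans (by linarith)
    split_ifs
    · simp [queries]
    · refine queries_query_le fun x => ?_
      split_ifs
      · exact queries_hunt_le (ih _) (by omega) h
      · exact queries_hunt_le (ih _) (by omega) h

lemma queries_repeatWalk_le (τ : ℝ) (m h n r : ℕ) :
    (repeatWalk τ m h n r : CondAlgorithm N).queries ≤ r * (n * (2 * m + h + 1)) := by
  induction r with
  | zero => simp [repeatWalk, queries]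
  | succ r ih =>
    rw [repeatWalk]
    refine (queries_walk_le _ _ _ _ _ _).trans ?_
    linarith

/-! ### The building blocks, analysed -/

section Blocks

variable {D : Fin 2 → PMF (Fin N)} {v : Verdict} {S : Finset (Fin N)}

/-- A quadratic lower bound passes through a comparison at the cost of the variance. -/
lemma prob_compare_ge {B : Finset (Fin N)} (h0 : 0 < mass (D 0) S) (h1 : 0 < mass (D 1) S)
    (hB : B ⊆ S) {k : ℤ → CondAlgorithm N} {α β c : ℝ} (hβ : 0 ≤ β)
    (hk : ∀ t : ℤ, α - β * (t - c) ^ 2 ≤ prob D v (k t)) (m : ℕ) (t : ℤ) :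
    α - β * ((t + m * (mass (D 0) B / mass (D 0) S - mass (D 1) B / mass (D 1) S) - c) ^ 2 + m / 2)
      ≤ prob D v (compare S B k m t) := by
  classical
  set p := mass (D 0) B / mass (D 0) S with hp
  set q := mass (D 1) B / mass (D 1) S with hq
  induction m generalizing t with
  | zero => simpa [compare] using hk t
  | succ m ih =>
    have inner : ∀ a : ℤ,
        q * (α - β * (((t + a - 1 : ℤ) + m * (p - q) - c) ^ 2 + m / 2))
          + (1 - q) * (α - β * (((t + a : ℤ) + m * (p - q) - c) ^ 2 + m / 2))
          ≤ prob D v (query 1 S fun y => compare S B k m (t + a - (if y ∈ B then 1 else 0))) := by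
      intro a
      refine prob_query_ge D v h1 hB (fun i hi _ => ?_) (fun i hi _ => ?_)
      · simpa only [if_pos hi] using ih (t + a - 1)
      · simpa only [if_neg (Finset.mem_sdiff.1 hi).2, sub_zero] using ih (t + a)
    have outer := prob_query_ge D v (o := 0) (S := S) (B := B)
      (next := fun x => query 1 S fun y =>
        compare S B k m (t + (if x ∈ B then 1 else 0) - (if y ∈ B then 1 else 0)))
      (x := q * (α - β * (((t + 1 - 1 : ℤ) + m * (p - q) - c) ^ 2 + m / 2))
          + (1 - q) * (α - β * (((t + 1 : ℤ) + m * (p - q) - c) ^ 2 + m / 2)))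
      (y := q * (α - β * (((t + 0 - 1 : ℤ) + m * (p - q) - c) ^ 2 + m / 2))
          + (1 - q) * (α - β * (((t + 0 : ℤ) + m * (p - q) - c) ^ 2 + m / 2)))
      h0 hB
      (fun i hi _ => by simpa only [if_pos hi] using inner 1)
      (fun i hi _ => by simpa only [if_neg (Finset.mem_sdiff.1 hi).2] using inner 0)
    have hrun : compare S B k (m + 1) t = query 0 S fun x => query 1 S fun y =>
        compare S B k m (t + (if x ∈ B then 1 else 0) - (if y ∈ B then 1 else 0)) := by
      rw [compare]
    rw [hrun]
    refine le_trans ?_ outer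
    rw [← hp]
    push_cast
    -- Averaging the square over one sample from either oracle shifts its centre by `p - q` and adds
    -- the variance `p (1 - p) + q (1 - q)`; this is the source of `m / 2`.
    have hvar : β * (p * (1 - p) + q * (1 - q)) ≤ β * (1 / 2) :=
      mul_le_mul_of_nonneg_left (by nlinarith [sq_nonneg (p - 1 / 2), sq_nonneg (q - 1 / 2)]) hβ
    linarith

lemma le_prob_compare {B : Finset (Fin N)} (h0 : 0 < mass (D 0) S) (h1 : 0 < mass (D 1) S)
    (hB : B ⊆ S) {k : ℤ → CondAlgorithm N} {α : ℝ} (hk : ∀ t, α ≤ prob D v (k t)) (m : ℕ) (t : ℤ) :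
    α ≤ prob D v (compare S B k m t) := by
  have h := prob_compare_ge (c := 0) h0 h1 hB le_rfl (fun t => by simpa using hk t) m t
  simpa using h

/-- All `h` samples miss `B` with probability `(1 - q) ^ h`. The bound on `hit` is needed only when
`B` has positive mass, since a sample in `B` certifies this. -/
lemma prob_hunt_ge {B : Finset (Fin N)} (h1 : 0 < mass (D 1) S) (hB : B ⊆ S)
    {hit miss : CondAlgorithm N} {a b : ℝ} (ha : 0 < mass (D 1) B → a ≤ prob D v hit)
    (hb : b ≤ prob D v miss) (h : ℕ) :
    b + (1 - (1 - mass (D 1) B / mass (D 1) S) ^ h) * (a - b)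
      ≤ prob D v (hunt S B hit miss h) := by
  classical
  induction h with
  | zero => simpa [hunt] using hb
  | succ h ih =>
    rw [hunt]
    refine le_trans (le_of_eq ?_) (prob_query_ge D v h1 hB (x := a)
      (y := b + (1 - (1 - mass (D 1) B / mass (D 1) S) ^ h) * (a - b))
      (fun i hi h0 => ?_) (fun i hi _ => ?_))
    · ring
    · rw [if_pos hi]
      exact ha (h0.trans_le (toReal_le_mass (D 1) hi))
    · rw [if_neg (Finset.mem_sdiff.1 hi).2]
      exact ih

lemma prob_descend_ge {h : ℕ} (h0 : 0 < mass (D 0) S)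
    {next : Finset (Fin N) → CondAlgorithm N} {K : CondAlgorithm N} {x y : ℝ}
    (hx : 0 < mass (D 0) (half S) → x ≤ prob D v (hunt S (half S) (next (half S)) K h))
    (hy : 0 < mass (D 0) (S \ half S) →
      y ≤ prob D v (hunt S (S \ half S) (next (S \ half S)) K h)) :
    mass (D 0) (half S) / mass (D 0) S * x + mass (D 0) (S \ half S) / mass (D 0) S * y
      ≤ prob D v (descend h S next K) := by
  rw [descend, mass_sdiff_div (D 0) (half_subset S) h0]
  refine prob_query_ge D v h0 (half_subset S) (fun i hi hi0 => ?_) (fun i hi hi0 => ?_)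
  · rw [if_pos hi]
    exact hx (hi0.trans_le (toReal_le_mass (D 0) hi))
  · rw [if_neg (Finset.mem_sdiff.1 hi).2]
    exact hy (hi0.trans_le (toReal_le_mass (D 0) hi))

lemma le_prob_descend {h : ℕ} (h0 : 0 < mass (D 0) S) (h1 : 0 < mass (D 1) S)
    {next : Finset (Fin N) → CondAlgorithm N} {K : CondAlgorithm N} {κ : ℝ}
    (hx : 0 < mass (D 0) (half S) → 0 < mass (D 1) (half S) → κ ≤ prob D v (next (half S)))
    (hy : 0 < mass (D 0) (S \ half S) → 0 < mass (D 1) (S \ half S) →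
      κ ≤ prob D v (next (S \ half S)))
    (hK : κ ≤ prob D v K) :
    κ ≤ prob D v (descend h S next K) := by
  have := prob_descend_ge (h := h) (next := next) (K := K) (x := κ) (y := κ) h0
    (fun hc => by simpa using prob_hunt_ge h1 (half_subset S) (hx hc) hK h)
    (fun hc => by simpa using prob_hunt_ge h1 Finset.sdiff_subset (hy hc) hK h)
  rwa [← add_mul, ← add_div, mass_add_sdiff (D 0) (half_subset S), div_self h0.ne', one_mul] at this

end Blocks

/-! ### Equal distributions -/

/-- The compared difference has mean zero and variance at most `m / 2`, so by Chebyshev each level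
costs at most `m / 2 / τ ^ 2`. An unsuccessful hunt costs nothing, as it leads to `K`. -/
lemma prob_accept_walk_ge (P : PMF (Fin N)) {τ : ℝ} (hτ : 0 < τ) (m h : ℕ) {K : CondAlgorithm N}
    {α : ℝ} (hK : α ≤ prob ![P, P] Verdict.accept K) (l : ℕ) {S : Finset (Fin N)}
    (hS : 0 < mass P S) :
    α - l * (m / 2 / τ ^ 2) ≤ prob ![P, P] Verdict.accept (walk τ m h K l S) := by
  induction l generalizing S with
  | zero => simpa [walk] using hK
  | succ l ih =>
    set γ := α - l * (m / 2 / τ ^ 2) with hγ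
    have hγα : γ ≤ α := by
      have : 0 ≤ l * (m / 2 / τ ^ 2) := by positivity
      linarith
    have hcont : γ ≤ prob ![P, P] Verdict.accept (descend h S (walk τ m h K l) K) :=
      le_prob_descend hS hS (fun hc _ => ih hc) (fun hc _ => ih hc) (hγα.trans hK)
    have hγ1 : γ ≤ 1 := hcont.trans (prob_le_one _ _ _)
    rw [walk]
    have := prob_compare_ge (D := ![P, P]) (v := Verdict.accept) (S := S) (B := half S)
      (k := fun t : ℤ => if τ < |(t : ℝ)| then halt Verdict.reject
        else descend h S (walk τ m h K l) K)
      (α := γ) (β := 1 / τ ^ 2) (c := 0) hS hS (half_subset S) (by positivity)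
      (fun t => ?_) m 0
    · refine le_trans (le_of_eq ?_) this
      rw [hγ]
      simp
      ring
    · rw [sub_zero]
      split_ifs with ht
      · refine le_trans ?_ (prob_nonneg _ _ _)
        have : τ ^ 2 ≤ (t : ℝ) ^ 2 := by
          rw [← sq_abs (t : ℝ)]
          exact pow_le_pow_left₀ hτ.le ht.le 2
        have : 1 ≤ 1 / τ ^ 2 * (t : ℝ) ^ 2 := by
          rw [one_div_mul_eq_div, le_div_iff₀ (by positivity)]
          linarith
        linarith
      · have : 0 ≤ 1 / τ ^ 2 * (t : ℝ) ^ 2 := by positivity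
        linarith

lemma prob_accept_repeatWalk_ge (P : PMF (Fin N)) {τ : ℝ} (hτ : 0 < τ) (m h n r : ℕ) :
    1 - r * (n * (m / 2 / τ ^ 2)) ≤ prob ![P, P] Verdict.accept (repeatWalk τ m h n r) := by
  induction r with
  | zero => simp [repeatWalk, prob_halt_self]
  | succ r ih =>
    rw [repeatWalk]
    refine le_trans (le_of_eq ?_) (prob_accept_walk_ge P hτ m h ih n (by simp [mass_univ]))
    push_cast
    ring

/-! ### Distant distributions -/

/-- The total variation distance of two distributions conditioned on `S`. -/
def condDist (P Q : PMF (Fin N)) (S : Finset (Fin N)) : ℝ :=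
  (1 / 2) * ∑ i ∈ S, |(P i).toReal / mass P S - (Q i).toReal / mass Q S|

lemma condDist_univ (P Q : PMF (Fin N)) : condDist P Q Finset.univ = dTV P Q := by
  simp [condDist, dTV, mass_univ]

lemma condDist_le_one (P Q : PMF (Fin N)) (S : Finset (Fin N)) : condDist P Q S ≤ 1 := by
  have key : ∀ R : PMF (Fin N), ∑ i ∈ S, (R i).toReal / mass R S ≤ 1 := fun R => by
    rw [← Finset.sum_div]
    exact mass_div_le_one R subset_rfl
  have : ∑ i ∈ S, |(P i).toReal / mass P S - (Q i).toReal / mass Q S|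
      ≤ ∑ i ∈ S, ((P i).toReal / mass P S + (Q i).toReal / mass Q S) :=
    Finset.sum_le_sum fun i _ => by
      have hP : 0 ≤ (P i).toReal / mass P S := div_nonneg ENNReal.toReal_nonneg (mass_nonneg P S)
      have hQ : 0 ≤ (Q i).toReal / mass Q S := div_nonneg ENNReal.toReal_nonneg (mass_nonneg Q S)
      rw [abs_le]
      constructor <;> linarith
  rw [Finset.sum_add_distrib] at this
  rw [condDist]
  linarith [key P, key Q]

lemma condDist_of_card_le_one {P Q : PMF (Fin N)} {S : Finset (Fin N)} (hS : S.card ≤ 1)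
    (hP : 0 < mass P S) (hQ : 0 < mass Q S) : condDist P Q S = 0 := by
  have key : ∀ R : PMF (Fin N), 0 < mass R S → ∀ i ∈ S, (R i).toReal / mass R S = 1 := by
    intro R hR i hi
    have hs : S = {i} := Finset.eq_singleton_iff_unique_mem.2
      ⟨hi, fun j hj => Finset.card_le_one.1 hS j hj i hi⟩
    have hm : mass R S = (R i).toReal := by rw [hs, mass, Finset.sum_singleton]
    rw [← hm, div_self hR.ne']
  rw [condDist, Finset.sum_eq_zero fun i hi => by rw [key P hP i hi, key Q hQ i hi]; simp, mul_zero]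

/-- Factor each conditional probability through `B` and change first the law inside `B`, then the
weight of `B`. Division by zero being zero, no positivity is needed. -/
lemma sum_abs_part_le (P Q : PMF (Fin N)) (S B : Finset (Fin N)) :
    (1 / 2) * ∑ i ∈ B, |(P i).toReal / mass P S - (Q i).toReal / mass Q S|
      ≤ mass P B / mass P S * condDist P Q B
        + (1 / 2) * |mass P B / mass P S - mass Q B / mass Q S| := by
  have fac : ∀ R : PMF (Fin N), ∀ i ∈ B,
      (R i).toReal / mass R S = mass R B / mass R S * ((R i).toReal / mass R B) := by
    intro R i hi
    rcases (mass_nonneg R B).eq_or_lt with h0 | h0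
    · have h1 := toReal_le_mass R hi
      have h2 : (R i).toReal = 0 := le_antisymm (h0 ▸ h1) ENNReal.toReal_nonneg
      simp [h2]
    · field_simp
  have hterm : ∀ i ∈ B, |(P i).toReal / mass P S - (Q i).toReal / mass Q S|
      ≤ mass P B / mass P S * |(P i).toReal / mass P B - (Q i).toReal / mass Q B|
        + |mass P B / mass P S - mass Q B / mass Q S| * ((Q i).toReal / mass Q B) := by
    intro i hi
    rw [fac P i hi, fac Q i hi]
    have e : mass P B / mass P S * ((P i).toReal / mass P B)
        - mass Q B / mass Q S * ((Q i).toReal / mass Q B)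
        = mass P B / mass P S * ((P i).toReal / mass P B - (Q i).toReal / mass Q B)
          + (mass P B / mass P S - mass Q B / mass Q S) * ((Q i).toReal / mass Q B) := by ring
    rw [e]
    refine (abs_add_le _ _).trans (le_of_eq ?_)
    rw [abs_mul, abs_mul, abs_of_nonneg (mass_div_nonneg P S B),
      abs_of_nonneg (div_nonneg ENNReal.toReal_nonneg (mass_nonneg Q B))]
  have hsum := Finset.sum_le_sum hterm
  rw [Finset.sum_add_distrib, ← Finset.mul_sum, ← Finset.mul_sum, ← Finset.sum_div] at hsum
  have hone : |mass P B / mass P S - mass Q B / mass Q S| * (mass Q B / mass Q B)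
      ≤ |mass P B / mass P S - mass Q B / mass Q S| :=
    mul_le_of_le_one_right (abs_nonneg _) (mass_div_le_one Q subset_rfl)
  rw [condDist]
  simp only [mass] at hsum hone ⊢
  linarith

/-- The hybrid argument for one level of the tree. -/
lemma condDist_le {P Q : PMF (Fin N)} {S B : Finset (Fin N)} (hB : B ⊆ S)
    (hP : 0 < mass P S) (hQ : 0 < mass Q S) :
    condDist P Q S ≤ mass P B / mass P S * condDist P Q B
        + mass P (S \ B) / mass P S * condDist P Q (S \ B)
        + |mass P B / mass P S - mass Q B / mass Q S| := by
  have h1 := sum_abs_part_le P Q S B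
  have h2 := sum_abs_part_le P Q S (S \ B)
  have h3 : |mass P (S \ B) / mass P S - mass Q (S \ B) / mass Q S|
      = |mass P B / mass P S - mass Q B / mass Q S| := by
    rw [mass_sdiff_div P hB hP, mass_sdiff_div Q hB hQ, sub_sub_sub_cancel_left, abs_sub_comm]
  rw [h3] at h2
  rw [condDist, ← Finset.sum_sdiff hB]
  linarith

/-- This is `x * exp (-x) ≤ 1` at `x = h * q`: a child is either light or hard to miss. -/
lemma mul_one_sub_pow_le {q : ℝ} (hq0 : 0 ≤ q) (hq1 : q ≤ 1) {h : ℕ} (hh : 0 < h) :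
    q * (1 - q) ^ h ≤ 1 / h := by
  have hh' : (0 : ℝ) < h := by exact_mod_cast hh
  rw [le_div_iff₀ hh']
  have hx : (1 - q) ^ h ≤ Real.exp (-(h * q)) := by
    have := pow_le_pow_left₀ (sub_nonneg.2 hq1) (Real.one_sub_le_exp_neg q) h
    rwa [← Real.exp_nat_mul, mul_neg] at this
  have hy : h * q * Real.exp (-(h * q)) ≤ 1 := by
    rw [Real.exp_neg, ← div_eq_mul_inv, div_le_one (Real.exp_pos _)]
    linarith [Real.add_one_le_exp (h * q)]
  have := mul_le_mul_of_nonneg_left hx (mul_nonneg hh'.le hq0)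
  linarith

lemma mul_one_sub_pow_le_add {p q : ℝ} (hq0 : 0 ≤ q) (hq1 : q ≤ 1) {h : ℕ} (hh : 0 < h) :
    p * (1 - q) ^ h ≤ 1 / h + |p - q| := by
  have h1 := mul_one_sub_pow_le hq0 hq1 hh
  have h2 : (p - q) * (1 - q) ^ h ≤ |p - q| := by
    refine (mul_le_mul_of_nonneg_right (le_abs_self _) (pow_nonneg (sub_nonneg.2 hq1) h)).trans ?_
    exact mul_le_of_le_one_right (abs_nonneg _) (pow_le_one₀ (sub_nonneg.2 hq1) (by linarith))
  linarith

/-! ### Rejection probability of a walk, and its amplification -/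

section Reject

variable {P Q : PMF (Fin N)} {S : Finset (Fin N)} {K : CondAlgorithm N}

/-- A walk either rejects or reaches `K`: the hunts keep every queried set of positive mass under
both distributions. -/
lemma prob_reject_le_walk (hP : 0 < mass P S) (hQ : 0 < mass Q S) (τ : ℝ) (m h l : ℕ) :
    prob ![P, Q] Verdict.reject K ≤ prob ![P, Q] Verdict.reject (walk τ m h K l S) := by
  induction l generalizing S with
  | zero => simp [walk]
  | succ l ih =>
    rw [walk]
    refine le_prob_compare hP hQ (half_subset S) (fun t => ?_) m 0
    split_ifs with ht
    · rw [prob_halt_self]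
      exact prob_le_one _ _ _
    · exact le_prob_descend hP hQ (fun hc hc' => ih hc hc') (fun hc hc' => ih hc hc') le_rfl

/-- A comparison at a node that the two distributions split differently. -/
lemma prob_reject_compare_ge {B : Finset (Fin N)} (hP : 0 < mass P S) (hQ : 0 < mass Q S)
    (hB : B ⊆ S) {κ τ : ℝ} (hκ1 : κ ≤ 1) (hτ : 0 < τ) {m : ℕ}
    (hm : 2 * τ ≤ m * |mass P B / mass P S - mass Q B / mass Q S|)
    {A : CondAlgorithm N} (hA : κ ≤ prob ![P, Q] Verdict.reject A)
    {k : ℤ → CondAlgorithm N} (hk1 : ∀ t : ℤ, τ < |(t : ℝ)| → k t = halt Verdict.reject)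
    (hk2 : ∀ t : ℤ, |(t : ℝ)| ≤ τ → k t = A) :
    κ + (1 - κ) * (1 - m / 2 / τ ^ 2) ≤ prob ![P, Q] Verdict.reject (compare S B k m 0) := by
  set μ := m * (mass P B / mass P S - mass Q B / mass Q S) with hμ
  have hμ2 : 2 * τ ≤ |μ| := by
    rwa [hμ, abs_mul, Nat.abs_cast]
  -- The parabola centred at the mean `μ` has height `1` there and falls to `κ` at distance `τ`; as
  -- `2 * τ ≤ |μ|`, every `t` below the threshold is at least that far away.
  have := prob_compare_ge (D := ![P, Q]) (v := Verdict.reject) (S := S) (B := B) (k := k)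
      (α := 1) (β := (1 - κ) / τ ^ 2) (c := μ) hP hQ hB
      (div_nonneg (by linarith) (by positivity)) (fun t => ?_) m 0
  · refine le_trans (le_of_eq ?_) this
    simp only [Matrix.cons_val_zero, Matrix.cons_val_one, ← hμ]
    push_cast
    ring
  · have h1κ : 0 ≤ 1 - κ := by linarith
    rcases lt_or_ge τ |(t : ℝ)| with ht | ht
    · rw [hk1 t ht, prob_halt_self]
      have : 0 ≤ (1 - κ) / τ ^ 2 * ((t : ℝ) - μ) ^ 2 := by positivity
      linarith
    · rw [hk2 t ht]
      refine le_trans ?_ hA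
      have h3 : τ ≤ |(t : ℝ) - μ| := by
        have := abs_sub_abs_le_abs_sub μ t
        rw [abs_sub_comm] at this
        linarith
      have h4 : τ ^ 2 ≤ ((t : ℝ) - μ) ^ 2 := by
        rw [← sq_abs ((t : ℝ) - μ)]
        exact pow_le_pow_left₀ hτ.le h3 2
      have h5 : (1 - κ) ≤ (1 - κ) / τ ^ 2 * ((t : ℝ) - μ) ^ 2 := by
        rw [div_mul_eq_mul_div, le_div_iff₀ (by positivity)]
        exact mul_le_mul_of_nonneg_left h4 h1κ
      linarith

lemma prob_reject_hunt_ge {B : Finset (Fin N)} (hQ : 0 < mass Q S) (hB : B ⊆ S)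
    {hit : CondAlgorithm N} {κ ρ : ℝ} (hκ1 : κ ≤ 1) (hρ : ρ ≤ 1)
    (hit_ge : 0 < mass Q B → κ + (1 - κ) * ρ ≤ prob ![P, Q] Verdict.reject hit)
    (hK : κ ≤ prob ![P, Q] Verdict.reject K) (h : ℕ) :
    κ + (1 - κ) * (ρ - (1 - mass Q B / mass Q S) ^ h)
      ≤ prob ![P, Q] Verdict.reject (hunt S B hit K h) := by
  refine le_trans ?_ (prob_hunt_ge (D := ![P, Q]) hQ hB hit_ge hK h)
  simp only [Matrix.cons_val_one]
  have hs : 0 ≤ (1 - mass Q B / mass Q S) ^ h :=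
    pow_nonneg (sub_nonneg.2 (mass_div_le_one Q hB)) h
  have := mul_nonneg (mul_nonneg (sub_nonneg.2 hκ1) hs) (sub_nonneg.2 hρ)
  simp only [Matrix.cons_val_fin_one]
  linarith

/-- The discrepancy `|p - q|` is paid once in `condDist_le` and once for the missed hunt in each
child, hence the factor `3`; the two hunts also give `2 / h`. -/
lemma prob_reject_descend_ge (hP : 0 < mass P S) (hQ : 0 < mass Q S) {h : ℕ} (hh : 0 < h)
    {next : Finset (Fin N) → CondAlgorithm N} {κ c : ℝ} (hκ1 : κ ≤ 1) (hc : 0 ≤ c)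
    (hx : 0 < mass P (half S) → 0 < mass Q (half S) →
      κ + (1 - κ) * (condDist P Q (half S) - c) ≤ prob ![P, Q] Verdict.reject (next (half S)))
    (hy : 0 < mass P (S \ half S) → 0 < mass Q (S \ half S) →
      κ + (1 - κ) * (condDist P Q (S \ half S) - c)
        ≤ prob ![P, Q] Verdict.reject (next (S \ half S)))
    (hK : κ ≤ prob ![P, Q] Verdict.reject K) :
    κ + (1 - κ) * (condDist P Q S - c - 2 / h
        - 3 * |mass P (half S) / mass P S - mass Q (half S) / mass Q S|)
      ≤ prob ![P, Q] Verdict.reject (descend h S next K) := by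
  have hB := half_subset S
  have hρ : ∀ B, condDist P Q B - c ≤ 1 := fun B => by
    linarith [condDist_le_one P Q B]
  refine le_trans ?_ (prob_descend_ge (D := ![P, Q]) (v := Verdict.reject) (h := h) hP
    (fun hc => prob_reject_hunt_ge hQ hB hκ1 (hρ _) (hx hc) hK h)
    (fun hc => prob_reject_hunt_ge hQ Finset.sdiff_subset hκ1 (hρ _) (hy hc) hK h))
  simp only [Matrix.cons_val_zero]
  have hd := condDist_le hB hP hQ
  have h1 := mul_one_sub_pow_le_add (p := mass P (half S) / mass P S)
    (mass_div_nonneg Q S (half S)) (mass_div_le_one Q hB) hh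
  have h2 := mul_one_sub_pow_le_add (p := mass P (S \ half S) / mass P S)
    (mass_div_nonneg Q S (S \ half S)) (mass_div_le_one Q Finset.sdiff_subset) hh
  have h3 : |mass P (S \ half S) / mass P S - mass Q (S \ half S) / mass Q S|
      = |mass P (half S) / mass P S - mass Q (half S) / mass Q S| := by
    rw [mass_sdiff_div P hB hP, mass_sdiff_div Q hB hQ, sub_sub_sub_cancel_left, abs_sub_comm]
  rw [h3] at h2
  have hpp : mass P (S \ half S) / mass P S = 1 - mass P (half S) / mass P S :=
    mass_sdiff_div P hB hP
  generalize (1 - mass Q (half S) / mass Q S) ^ h = s at *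
  generalize (1 - mass Q (S \ half S) / mass Q S) ^ h = s' at *
  generalize |mass P (half S) / mass P S - mass Q (half S) / mass Q S| = e at *
  rw [hpp] at *
  generalize mass P (half S) / mass P S = p at *
  generalize condDist P Q S = d at *
  generalize condDist P Q (half S) = d₁ at *
  generalize condDist P Q (S \ half S) = d₂ at *
  have hfin : d - c - 2 / h - 3 * e ≤ p * (d₁ - c - s) + (1 - p) * (d₂ - c - s') := by
    have : (2 : ℝ) / h = 1 / h + 1 / h := by ring
    rw [this]
    linarith
  have := mul_le_mul_of_nonneg_left hfin (sub_nonneg.2 hκ1)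
  linarith

/-- The form `κ + (1 - κ) * ρ` says that the walk itself rejects with probability `ρ` and otherwise
hands over to `K`. The Chebyshev error enters once rather than per level, because the induction
stops at the first node with discrepancy at least `2 * δ`. -/
lemma prob_reject_walk_ge {δ : ℝ} (hδ : 0 < δ) {m h : ℕ} (hm : 0 < m) (hh : 0 < h) (l : ℕ)
    (hS : S.card ≤ 2 ^ l) (hP : 0 < mass P S) (hQ : 0 < mass Q S) :
    prob ![P, Q] Verdict.reject K + (1 - prob ![P, Q] Verdict.reject K) *
        (condDist P Q S - (l * (6 * δ + 2 / h) + 1 / (2 * m * δ ^ 2)))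
      ≤ prob ![P, Q] Verdict.reject (walk (m * δ) m h K l S) := by
  have hm' : (0 : ℝ) < m := by exact_mod_cast hm
  set κ := prob ![P, Q] Verdict.reject K with hκ
  have hκ1 : κ ≤ 1 := prob_le_one _ _ _
  have hκ1' : 0 ≤ 1 - κ := sub_nonneg.2 hκ1
  induction l generalizing S with
  | zero =>
    rw [condDist_of_card_le_one (by simpa using hS) hP hQ, walk, ← hκ]
    have : 0 ≤ (1 - κ) * (1 / (2 * m * δ ^ 2)) := by positivity
    push_cast
    linarith
  | succ l ih =>
    rcases le_or_gt (2 * δ) |mass P (half S) / mass P S - mass Q (half S) / mass Q S|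
      with hbad | hgood
    · rw [walk]
      refine le_trans ?_ (prob_reject_compare_ge (κ := κ) (τ := m * δ)
        (A := descend h S (walk (m * δ) m h K l) K)
        hP hQ (half_subset S) hκ1 (by positivity) ?_ ?_ ?_ ?_)
      · have e : (m : ℝ) / 2 / (m * δ) ^ 2 = 1 / (2 * m * δ ^ 2) := by
          field_simp
        rw [e]
        have h1 := condDist_le_one P Q S
        have h2 : 0 ≤ ((l + 1 : ℕ) : ℝ) * (6 * δ + 2 / h) := by positivity
        have := mul_le_mul_of_nonneg_left
          (by linarith : condDist P Q S - (((l + 1 : ℕ) : ℝ) * (6 * δ + 2 / h)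
            + 1 / (2 * m * δ ^ 2)) ≤ 1 - 1 / (2 * m * δ ^ 2)) hκ1'
        linarith
      · have := mul_le_mul_of_nonneg_left hbad hm'.le
        linarith
      · exact le_prob_descend hP hQ (fun hc hc' => prob_reject_le_walk hc hc' _ _ _ _)
          (fun hc hc' => prob_reject_le_walk hc hc' _ _ _ _) le_rfl
      · intro t ht
        rw [if_pos ht]
      · intro t ht
        rw [if_neg ht.not_gt]
    -- Here `3 * |p - q| < 6 * δ`, the loss allowed per level. No accuracy of the comparison is
    -- used, since rejecting is the desired outcome.
    · have hcont := prob_reject_descend_ge (K := K) (h := h) (next := walk (m * δ) m h K l)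
        (κ := κ) (c := l * (6 * δ + 2 / h) + 1 / (2 * m * δ ^ 2)) hP hQ hh hκ1 (by positivity)
        (fun hc hc' => ih (card_half_le hS) hc hc' )
        (fun hc hc' => ih (card_sdiff_half_le hS) hc hc') le_rfl
      have hle : κ + (1 - κ) * (condDist P Q S - (((l + 1 : ℕ) : ℝ) * (6 * δ + 2 / h)
            + 1 / (2 * m * δ ^ 2)))
          ≤ prob ![P, Q] Verdict.reject (descend h S (walk (m * δ) m h K l) K) := by
        refine le_trans ?_ hcont
        push_cast
        have := mul_le_mul_of_nonneg_left hgood.le hκ1'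
        linarith
      rw [walk]
      refine le_prob_compare hP hQ (half_subset S) (fun t => ?_) m 0
      split_ifs with ht
      · rw [prob_halt_self]
        exact hle.trans (prob_le_one _ _ _)
      · exact hle

lemma prob_reject_repeatWalk_ge {δ c : ℝ} (hδ : 0 < δ) {m h n : ℕ} (hm : 0 < m) (hh : 0 < h)
    (hn : N ≤ 2 ^ n) (hc1 : c ≤ 1)
    (hc : c ≤ dTV P Q - (n * (6 * δ + 2 / h) + 1 / (2 * m * δ ^ 2))) (r : ℕ) :
    1 - (1 - c) ^ r ≤ prob ![P, Q] Verdict.reject (repeatWalk (m * δ) m h n r) := by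
  induction r with
  | zero => simpa using prob_nonneg _ _ _
  | succ r ih =>
    rw [repeatWalk]
    refine le_trans ?_ (prob_reject_walk_ge (P := P) (Q := Q) hδ hm hh n (by simpa using hn)
      (by simp [mass_univ]) (by simp [mass_univ]))
    rw [condDist_univ]
    have hκ1 := prob_le_one ![P, Q] Verdict.reject (repeatWalk (m * δ) m h n r)
    have h1 := mul_le_mul_of_nonneg_left hc (sub_nonneg.2 hκ1)
    have h2 := mul_le_mul_of_nonneg_right ih (sub_nonneg.2 hc1)
    rw [pow_succ]
    linarith

end Reject

/-! ### The tester -/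

/-- The equality tester for distributions over `N` elements and distance parameter `ε`. -/
def equalityTester (N : ℕ) (ε : ℝ) : CondAlgorithm N :=
  repeatWalk (⌈7776 * (Nat.clog 2 N / ε) ^ 3⌉₊ * (ε / (24 * Nat.clog 2 N)))
    ⌈7776 * (Nat.clog 2 N / ε) ^ 3⌉₊ ⌈8 * (Nat.clog 2 N / ε)⌉₊ (Nat.clog 2 N) ⌈8 / ε⌉₊

lemma queries_equalityTester_le (N : ℕ) {ε : ℝ} (hε : 0 < ε) (hε1 : ε ≤ 1) :
    ((equalityTester N ε).queries : ℝ) ≤ 150000 * (Nat.clog 2 N / ε) ^ 4 := by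
  have h := queries_repeatWalk_le (N := N)
    (⌈7776 * (Nat.clog 2 N / ε) ^ 3⌉₊ * (ε / (24 * Nat.clog 2 N)))
    ⌈7776 * (Nat.clog 2 N / ε) ^ 3⌉₊ ⌈8 * (Nat.clog 2 N / ε)⌉₊ (Nat.clog 2 N) ⌈8 / ε⌉₊
  rw [← equalityTester] at h
  rcases Nat.eq_zero_or_pos (Nat.clog 2 N) with h0 | h0
  · rw [h0] at h ⊢
    have : (equalityTester N ε).queries = 0 := by simpa using h
    simp [this]
  · set n := Nat.clog 2 N
    have hn : (1 : ℝ) ≤ n := by exact_mod_cast h0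
    have hx : 1 ≤ n / ε := by rw [le_div_iff₀ hε]; linarith
    have hε' : 1 ≤ 1 / ε := by rw [le_div_iff₀ hε]; linarith
    have hm := (Nat.ceil_lt_add_one (by positivity : 0 ≤ 7776 * (n / ε) ^ 3)).le
    have hh := (Nat.ceil_lt_add_one (by positivity : 0 ≤ 8 * (n / ε))).le
    have hr := (Nat.ceil_lt_add_one (by positivity : 0 ≤ 8 / ε)).le
    have h' : ((equalityTester N ε).queries : ℝ) ≤ _ := Nat.cast_le.2 h
    push_cast at h'
    refine h'.trans ?_
    have h1 : (n / ε) ≤ (n / ε) ^ 3 := le_self_pow₀ hx (by norm_num)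
    have hr' : (⌈8 / ε⌉₊ : ℝ) ≤ 9 * (1 / ε) := by
      have : 8 / ε = 8 * (1 / ε) := by ring
      linarith
    -- `15564 = 2 * 7776 + 8 + 4`, the `4` collecting the roundings and the descent query.
    have hb : 2 * (⌈7776 * (n / ε) ^ 3⌉₊ : ℝ) + ⌈8 * (n / ε)⌉₊ + 1 ≤ 15564 * (n / ε) ^ 3 := by
      linarith
    calc (⌈8 / ε⌉₊ : ℝ) * (n * (2 * (⌈7776 * (n / ε) ^ 3⌉₊ : ℝ) + ⌈8 * (n / ε)⌉₊ + 1))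
        ≤ 9 * (1 / ε) * (n * (15564 * (n / ε) ^ 3)) := by gcongr
      _ = 140076 * (n / ε) ^ 4 := by ring
      _ ≤ 150000 * (n / ε) ^ 4 := by gcongr; norm_num

lemma isEqualityTester_equalityTester {N : ℕ} {ε : ℝ} (hε : 0 < ε) (hε1 : ε ≤ 1) :
    IsEqualityTester (equalityTester N ε) ε := by
  intro P Q
  change (P = Q → 2 / 3 ≤ prob ![P, Q] Verdict.accept (equalityTester N ε)) ∧
    (ε ≤ dTV P Q → 2 / 3 ≤ prob ![P, Q] Verdict.reject (equalityTester N ε))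
  have hN : N ≤ 2 ^ Nat.clog 2 N := Nat.le_pow_clog one_lt_two N
  rw [equalityTester]
  rcases Nat.eq_zero_or_pos (Nat.clog 2 N) with h0 | h0
  -- With at most one point the walks have length zero, so the tester accepts at once, and no two
  -- distributions are distant.
  · rw [h0] at hN ⊢
    constructor
    · rintro rfl
      have key : ∀ (τ : ℝ) (m h r : ℕ), (repeatWalk τ m h 0 r : CondAlgorithm N)
          = halt Verdict.accept := by
        intro τ m h r
        induction r with
        | zero => rfl
        | succ r ih => rw [repeatWalk, walk, ih]
      rw [key, prob_halt_self]
      norm_num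
    · intro hd
      rw [← condDist_univ, condDist_of_card_le_one (by simpa using hN) (by simp [mass_univ])
        (by simp [mass_univ])] at hd
      linarith
  · set n := Nat.clog 2 N
    have hn : (1 : ℝ) ≤ n := by exact_mod_cast h0
    have hn0 : (0 : ℝ) < n := by linarith
    have hx : 0 < n / ε := by positivity
    set m := ⌈7776 * (n / ε) ^ 3⌉₊
    set h := ⌈8 * (n / ε)⌉₊
    set r := ⌈8 / ε⌉₊
    have hm : 7776 * (n / ε) ^ 3 ≤ (m : ℝ) := Nat.le_ceil _
    have hh : 8 * (n / ε) ≤ (h : ℝ) := Nat.le_ceil _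
    have hr : 8 / ε ≤ (r : ℝ) := Nat.le_ceil _
    have hr2 : (r : ℝ) ≤ 9 / ε := by
      have h1 := (Nat.ceil_lt_add_one (by positivity : 0 ≤ 8 / ε)).le
      have h2 : 1 ≤ 1 / ε := by rw [le_div_iff₀ hε]; linarith
      have h3 : 9 / ε = 8 / ε + 1 / ε := by ring
      linarith
    have hm0 : (0 : ℝ) < m := lt_of_lt_of_le (by positivity) hm
    have hh0 : (0 : ℝ) < h := lt_of_lt_of_le (by positivity) hh
    set δ := ε / (24 * n) with hδ
    have hδ0 : 0 < δ := by positivity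
    -- `7776 = 288 * 27`: with at most `9 / ε` walks of `n` comparisons each, this error per
    -- comparison sums to `1 / 3`.
    have hη : 1 / (2 * m * δ ^ 2) ≤ ε / (27 * n) := by
      have : 1 / (2 * m * δ ^ 2) = 288 * (n / ε) ^ 2 / m := by
        rw [hδ]
        field_simp
        norm_num
      rw [this, div_le_iff₀ hm0]
      have h2 := mul_le_mul_of_nonneg_left hm (by positivity : 0 ≤ ε / (27 * n))
      refine le_trans (le_of_eq ?_) h2
      field_simp
      norm_num
    constructor
    · rintro rfl
      refine le_trans ?_ (prob_accept_repeatWalk_ge P (by positivity) m h n r)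
      have e : (m : ℝ) / 2 / (m * δ) ^ 2 = 1 / (2 * m * δ ^ 2) := by
        field_simp
      rw [e]
      have : (r : ℝ) * (n * (1 / (2 * m * δ ^ 2))) ≤ 9 / ε * (n * (ε / (27 * n))) := by gcongr
      have e2 : 9 / ε * (n * (ε / (27 * n))) = 1 / 3 := by
        field_simp
        norm_num
      linarith
    · intro hd
      -- Of the distance `ε`, the thresholds use `ε / 4`, the hunts at most `ε / 4` and the
      -- Chebyshev error at most `ε / 27`.
      refine le_trans ?_ (prob_reject_repeatWalk_ge (c := ε / 4) hδ0 (Nat.cast_pos.1 hm0)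
        (Nat.cast_pos.1 hh0) hN (by linarith) ?_ r)
      · have h1 : (1 - ε / 4) ^ r ≤ Real.exp (-(r * (ε / 4))) := by
          have := pow_le_pow_left₀ (by linarith) (Real.one_sub_le_exp_neg (ε / 4)) r
          rwa [← Real.exp_nat_mul, mul_neg] at this
        have h2 : 2 ≤ r * (ε / 4) := by
          have := mul_le_mul_of_nonneg_right hr (by positivity : 0 ≤ ε / 4)
          refine le_trans (le_of_eq ?_) this
          field_simp
          norm_num
        have h3 : Real.exp (-(r * (ε / 4))) ≤ 1 / 3 := by
          rw [Real.exp_neg, ← one_div]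
          exact one_div_le_one_div_of_le (by norm_num)
            (by linarith [Real.add_one_le_exp (r * (ε / 4))])
        linarith
      · have e1 : n * (6 * δ) = ε / 4 := by
          rw [hδ]
          field_simp
          norm_num
        have e2 : n * (2 / h) ≤ ε / 4 := by
          rw [mul_div_assoc', div_le_iff₀ hh0]
          have := mul_le_mul_of_nonneg_left hh (by positivity : 0 ≤ ε / 4)
          refine le_trans (le_of_eq ?_) this
          field_simp
          norm_num
        have e3 : ε / (27 * n) ≤ ε / 27 := by
          gcongr
          linarith
        linarith

/-- For `N ≥ 2` both `2 ^ (clog - 1)` and `2` are at most `N`, so `clog * log 2 ≤ 2 * log N`, and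
`log 2 > 2 / 3`. -/
lemma clog_le_log {N : ℕ} (hN : 1 ≤ N) : (Nat.clog 2 N : ℝ) ≤ 3 * Real.log N := by
  rcases hN.eq_or_lt with rfl | hN
  · simp
  · have h1 := Nat.pow_pred_clog_lt_self one_lt_two hN
    have h0 : 0 < Nat.clog 2 N := Nat.clog_pos one_lt_two hN
    obtain ⟨k, hk⟩ := Nat.exists_eq_succ_of_ne_zero h0.ne'
    rw [hk] at h1 ⊢
    have h2 : (2 : ℝ) ^ k ≤ N := by exact_mod_cast h1.le
    have h3 := Real.log_le_log (by positivity) h2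
    rw [Real.log_pow] at h3
    have h4 : Real.log 2 ≤ Real.log N := Real.log_le_log (by norm_num) (by exact_mod_cast hN)
    have h5 := Real.log_two_gt_d9
    have h6 : (2 / 3 : ℝ) * (k + 1) ≤ Real.log 2 * (k + 1) := by
      gcongr
      linarith
    push_cast
    linarith

lemma isSoftO_queries_equalityTester :
    IsSoftO {p : ℕ × ℝ | 1 ≤ p.1 ∧ 0 < p.2 ∧ p.2 ≤ 1}
      (fun p => ((equalityTester p.1 p.2).queries : ℝ))
      (fun p => Real.log p.1 ^ 5 / p.2 ^ 4) := by
  -- No logarithmic factor is needed: the fourth power of the natural number `clog` is at most its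
  -- fifth, and `243 = 3 ^ 5`.
  refine ⟨150000 * 243, 0, ?_⟩
  rintro ⟨N, ε⟩ ⟨hN, hε, hε1⟩
  dsimp only at hN hε hε1 ⊢
  refine (queries_equalityTester_le N hε hε1).trans ?_
  have h1 := clog_le_log hN
  have h2 : (Nat.clog 2 N : ℝ) ^ 4 ≤ (Nat.clog 2 N : ℝ) ^ 5 := by
    rcases Nat.eq_zero_or_pos (Nat.clog 2 N) with h0 | h0
    · simp [h0]
    · exact pow_le_pow_right₀ (by exact_mod_cast h0) (by norm_num)
  have h3 : (Nat.clog 2 N : ℝ) ^ 5 ≤ (3 * Real.log N) ^ 5 :=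
    pow_le_pow_left₀ (Nat.cast_nonneg _) h1 5
  rw [pow_zero, mul_one, div_pow, mul_assoc]
  refine mul_le_mul_of_nonneg_left ?_ (by norm_num)
  rw [mul_div_assoc', div_le_div_iff_of_pos_right (by positivity)]
  linarith [h2.trans h3, mul_pow 3 (Real.log N) 5]

end CondAlgorithm

end CondTesting

end

theorem theorem6p2 :
    ∃ T : (N : ℕ) → (ε : ℝ) → CondTesting.CondAlgorithm N,
      CondTesting.IsSoftO {p : ℕ × ℝ | 1 ≤ p.1 ∧ 0 < p.2 ∧ p.2 ≤ 1}
        (fun p => ((T p.1 p.2).queries : ℝ))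
        (fun p => Real.log p.1 ^ 5 / p.2 ^ 4) ∧
      ∀ (N : ℕ) (ε : ℝ), 1 ≤ N → 0 < ε → ε ≤ 1 →
        CondTesting.IsEqualityTester (T N ε) ε :=
  ⟨CondTesting.CondAlgorithm.equalityTester,
    CondTesting.CondAlgorithm.isSoftO_queries_equalityTester,
    fun _ _ _ hε hε1 => CondTesting.CondAlgorithm.isEqualityTester_equalityTester hε hε1⟩
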